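/- Let $2^\omega$ carry the metric $d(x,y)=2^{-\min\{n:\,x(n)\neq y(n)\}}$ for $x\ne y$, and let $\mathcal H^s$ be $s$-dimensional Hausdorff measure with respect to $d$. Let $W_e\subseteq\omega$ be the $e$-th computably enumerable set, and write $x\upharpoonright n$ for the initial segment of $x$ of length $n$. Fixing the standard computable codings $\langle\cdot,\cdot\rangle$ of pairs and of finite strings by natural numbers, let $$P_e=\{x\in 2^\omega:\ \forall n\,\exists m\ \ \langle n,x\upharpoonright m\rangle\in W_e\}$$ be the $e$-th $\Pi^0_2$ class and $$S_e=\{x\in 2^\omega:\ \exists g\in\omega^\omega\,\forall n\ \ \langle x\upharpoonright n,g\upharpoonright n\rangle\notin W_e\}$$ be the $e$-th (lightface) $\Sigma^1_1$ class. A set $A\subseteq\omega$ is $\Sigma^1_1$ if there is a computable relation $R$ such that $k\in A\iff\exists f\in\omega^\omega\,\forall n\ R(k,f\upharpoonright n)$; it is $\Sigma^1_1$-complete if it is $\Sigma^1_1$ and every $\Sigma^1_1$ subset of $\omega$ is many-one reducible to it. Theorem. For every rational $s$ with $0<s<1$, the set $\{e:\mathcal H^s(P_e)\neq 0\}$ of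 indices of $\Pi^0_2$ classes of non-zero $\mathcal H^s$-measure is $\Sigma^1_1$-complete. Moreover, the set $\{e:\mathcal H^s(S_e)\neq 0\}$ of indices of $\Sigma^1_1$ classes of non-zero $\mathcal H^s$-measure is also $\Sigma^1_1$. -/

import Mathlib

namespace EffectiveCantor

/-- Cantor space `2^ω`. -/
abbrev Cantor : Type := ℕ → Bool

/-- The initial segment `x ↾ n` of an infinite sequence `x`, the finite string
`⟨x 0, …, x (n - 1)⟩`. -/
def restrict {α : Type} (x : ℕ → α) (n : ℕ) : List α := (List.range n).map x

/-- The `s`-dimensional Hausdorff measure on Cantor space with respect to the standard metric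
`d(x, y) = 2^{-min {n | x n ≠ y n}}` for `x ≠ y` (this is the distance of `PiNat.metricSpace`). -/
noncomputable def hausdorff (s : ℝ) : MeasureTheory.Measure Cantor :=
  letI : MetricSpace Cantor := PiNat.metricSpace
  MeasureTheory.Measure.hausdorffMeasure s

/-- The `e`-th computably enumerable set `W_e`, the domain of the `e`-th partial computable
function. -/
def ceSet (e : ℕ) : Set ℕ :=
  {k | ((Denumerable.ofNat Nat.Partrec.Code e).eval k).Dom}

/-- The `e`-th `Π⁰₂` class in Cantor space: the intersection over `n` of the uniformly effectively
open sets generated by the strings `σ` with `⟨n, σ⟩ ∈ W_e`. -/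
def pi02Class (e : ℕ) : Set Cantor :=
  {x | ∀ n : ℕ, ∃ m : ℕ, Encodable.encode (n, restrict x m) ∈ ceSet e}

/-- The `e`-th (lightface) `Σ¹₁` class in Cantor space: the projection along Baire space of the
`e`-th `Π⁰₁` class in `2^ω × ω^ω`, the set of pairs `(x, g)` none of whose initial segments
`(x ↾ n, g ↾ n)` is enumerated into `W_e`. -/
def sigma11Class (e : ℕ) : Set Cantor :=
  {x | ∃ g : ℕ → ℕ, ∀ n : ℕ, Encodable.encode (restrict x n, restrict g n) ∉ ceSet e}

/-- A set `A` of natural numbers is (lightface) `Σ¹₁` if for some computable relation `R`,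
`k ∈ A ↔ ∃ f ∈ ω^ω, ∀ n, R(k, f ↾ n)`. -/
def IsSigma11 (A : Set ℕ) : Prop :=
  ∃ R : ℕ × List ℕ → Prop, ComputablePred R ∧
    ∀ k : ℕ, k ∈ A ↔ ∃ f : ℕ → ℕ, ∀ n : ℕ, R (k, restrict f n)

/-- `A` is `Σ¹₁`-complete: it is `Σ¹₁`, and every `Σ¹₁` set of natural numbers is many-one
reducible to it (by a total computable function). -/
def IsSigma11Complete (A : Set ℕ) : Prop :=
  IsSigma11 A ∧ ∀ B : Set ℕ, IsSigma11 B → (fun k => k ∈ B) ≤₀ (fun k => k ∈ A)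

end EffectiveCantor

/-! Write s = p/q. A set is null for the s-dimensional measure exactly when it is null for the
content built from covers by arbitrary cylinders, a string of length n weighing 2^(-⌊pn/q⌋)
(`hausdorff_eq_zero_iff`): rounding costs only constants, and a cover of tiny total weight uses only
long strings.

Upper bound. Both kinds of class are projections along Baire space of the infinite paths through a
set T of pairs of strings. Literally, positive content says that every light cover misses a point,
which has the wrong quantifier order. The increasing sets lemma (`content_iUnion_of_monotone`)
repairs this: content is continuous along increasing unions of arbitrary sets, so a bound h on the
witnesses can be chosen one coordinate at a time while the content stays above a fixed c > 0. Under
such a bound compactness applies, and positivity becomes: there is h such that every light finite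
family of strings is escaped, at every finite level, by a finite pair of strings
(`content_proj_ne_zero_iff`). This is Σ¹₁ after Skolemization.

Hardness. Given B in Σ¹₁ with matrix R, let the bits of x at multiples of q spell in unary a
function f, and require R(k, f ↾ n) for all n. This is a Π⁰₂ condition on x. If k ∉ B the class is
empty. If k ∈ B all other bits are free, and the uniform measure on them shows positive content
because p/q ≤ 1 - 1/q (`content_ne_zero_of_sparse`). -/

namespace EffectiveCantor

open Set
open scoped ENNReal

/-! ### Initial segments of sequences -/

section Restrict

variable {α : Type}

@[simp]
theorem length_restrict (x : ℕ → α) (n : ℕ) : (restrict x n).length = n := by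
  simp [restrict]

theorem restrict_succ (x : ℕ → α) (n : ℕ) : restrict x (n + 1) = restrict x n ++ [x n] := by
  simp [restrict, List.range_succ]

theorem restrict_eq_iff {x y : ℕ → α} {n : ℕ} :
    restrict x n = restrict y n ↔ ∀ i < n, x i = y i := by
  simp [restrict]

theorem getElem_restrict (x : ℕ → α) (n i : ℕ) (h : i < (restrict x n).length) :
    (restrict x n)[i] = x i := by
  simp [restrict]

theorem getD_restrict {x : ℕ → α} {n i : ℕ} (h : i < n) (d : α) :
    (restrict x n).getD i d = x i := by
  simp [restrict, h]

theorem take_restrict (x : ℕ → α) {m n : ℕ} (h : m ≤ n) :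
    (restrict x n).take m = restrict x m := by
  apply List.ext_getElem
  · simpa using h
  · intro i h₁ h₂
    simp [restrict]

theorem restrict_isPrefix (x : ℕ → α) {m n : ℕ} (h : m ≤ n) : restrict x m <+: restrict x n := by
  rw [← take_restrict x h]
  exact List.take_prefix _ _

/-- Any property of finite strings which holds of the empty string and passes to some one-element
extension holds of all initial segments of some sequence. -/
theorem exists_forall_restrict [Nonempty α] {P : List α → Prop} (h0 : P [])
    (hs : ∀ u, P u → ∃ a, P (u ++ [a])) : ∃ x : ℕ → α, ∀ n, P (restrict x n) := by
  choose! a ha using hs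
  let u : ℕ → List α := fun n => Nat.rec [] (fun _ v => v ++ [a v]) n
  have hu : ∀ n, u n = restrict (fun i => a (u i)) n := by
    intro n
    induction n with
    | zero => rfl
    | succ n ih => rw [restrict_succ, ← ih]
  refine ⟨fun i => a (u i), fun n => ?_⟩
  rw [← hu]
  induction n with
  | zero => exact h0
  | succ n ih => exact ha _ ih

end Restrict

/-! ### Cylinder content and the increasing sets lemma -/

/-- The set of infinite binary sequences extending the string `σ`. -/
def cyl (σ : List Bool) : Set Cantor := {x | restrict x σ.length = σ}

@[simp]
theorem cyl_nil : cyl [] = univ := by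
  simp [cyl, restrict]

theorem isPrefix_of_mem_cyl {x : Cantor} {σ τ : List Bool} (hσ : x ∈ cyl σ) (hτ : x ∈ cyl τ)
    (h : σ.length ≤ τ.length) : σ <+: τ := by
  rw [← show _ = σ from hσ, ← show _ = τ from hτ]
  exact restrict_isPrefix x h

theorem cyl_subset_cyl {σ τ : List Bool} (h : σ <+: τ) : cyl τ ⊆ cyl σ := by
  intro x hx
  have h1 := restrict_isPrefix x h.length_le
  rw [show restrict x τ.length = τ from hx] at h1
  exact (List.prefix_of_prefix_length_le h1 h (by simp)).eq_of_length (by simp)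

/-- The content of a set of binary sequences obtained from coverings by arbitrary cylinders, where
a cylinder over a string of length `n` has weight `w n`. -/
noncomputable def content (w : ℕ → ℝ≥0∞) (A : Set Cantor) : ℝ≥0∞ :=
  ⨅ (F : Set (List Bool)) (_ : A ⊆ ⋃ σ ∈ F, cyl σ), ∑' σ : F, w σ.1.length

variable {w : ℕ → ℝ≥0∞} {A B : Set Cantor}

theorem content_le {F : Set (List Bool)} (h : A ⊆ ⋃ σ ∈ F, cyl σ) :
    content w A ≤ ∑' σ : F, w σ.1.length :=
  iInf₂_le F h

theorem exists_cover_of_content_lt {c : ℝ≥0∞} (h : content w A < c) :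
    ∃ F : Set (List Bool), A ⊆ ⋃ σ ∈ F, cyl σ ∧ ∑' σ : F, w σ.1.length < c := by
  simpa only [content, iInf_lt_iff, exists_prop] using h

theorem content_mono (h : A ⊆ B) : content w A ≤ content w B :=
  le_iInf₂ fun _ hF => content_le (h.trans hF)

theorem content_le_of_subset_cyl {σ : List Bool} (h : A ⊆ cyl σ) : content w A ≤ w σ.length := by
  refine (content_le (F := {σ}) (by simpa using h)).trans ?_
  simp

theorem content_iUnion_le {ι : Type*} [Countable ι] (B : ι → Set Cantor) :
    content w (⋃ i, B i) ≤ ∑' i, content w (B i) := by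
  refine ENNReal.le_of_forall_pos_le_add fun ε hε hfin => ?_
  obtain ⟨δ, hδ, hsum⟩ := ENNReal.exists_pos_sum_of_countable (ENNReal.coe_pos.2 hε).ne' ι
  have hlt : ∀ i, content w (B i) < content w (B i) + δ i := fun i =>
    ENNReal.lt_add_right (ne_top_of_le_ne_top hfin.ne (ENNReal.le_tsum i))
      (ENNReal.coe_pos.2 (hδ i)).ne'
  choose F hF hFs using fun i => exists_cover_of_content_lt (hlt i)
  have hcov : (⋃ i, B i) ⊆ ⋃ σ ∈ ⋃ i, F i, cyl σ := by
    refine iUnion_subset fun i => (hF i).trans ?_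
    exact biUnion_subset_biUnion_left (subset_iUnion F i)
  calc content w (⋃ i, B i) ≤ ∑' σ : ⋃ i, F i, w σ.1.length := content_le hcov
    _ ≤ ∑' i, ∑' σ : F i, w σ.1.length :=
        ENNReal.tsum_iUnion_le_tsum (fun σ : List Bool => w σ.length) F
    _ ≤ ∑' i, (content w (B i) + δ i) := ENNReal.tsum_le_tsum fun i => (hFs i).le
    _ = ∑' i, content w (B i) + ∑' i, (δ i : ℝ≥0∞) := ENNReal.tsum_add
    _ ≤ ∑' i, content w (B i) + ε := by gcongr

theorem content_union_le : content w (A ∪ B) ≤ content w A + content w B := by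
  have h := content_iUnion_le (w := w) (fun b : Bool => cond b A B)
  rwa [← union_eq_iUnion, tsum_bool, add_comm] at h

theorem content_biUnion_le (F : Set (List Bool)) (B : List Bool → Set Cantor) :
    content w (⋃ σ ∈ F, B σ) ≤ ∑' σ : F, content w (B σ) := by
  rw [biUnion_eq_iUnion]
  exact content_iUnion_le _

theorem content_iUnion_null {B : ℕ → Set Cantor} (h : ∀ n, content w (B n) = 0) :
    content w (⋃ n, B n) = 0 :=
  le_antisymm ((content_iUnion_le B).trans (by simp [h])) bot_le

/-- As long as the content of `A` inside a cylinder is less than the weight of the cylinder, it is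
superadditive under splitting the cylinder. -/
theorem content_split (hw : Antitone w) {σ : List Bool}
    (h : content w (A ∩ cyl σ) < w σ.length) :
    content w (A ∩ cyl (σ ++ [false])) + content w (A ∩ cyl (σ ++ [true])) ≤
      content w (A ∩ cyl σ) := by
  refine le_of_forall_gt fun c hc => ?_
  obtain ⟨F, hF, hFc⟩ := exists_cover_of_content_lt (lt_min hc h)
  rw [lt_min_iff] at hFc
  let G : Bool → Set (List Bool) := fun b => {τ ∈ F | σ ++ [b] <+: τ}
  have hG : ∀ b, content w (A ∩ cyl (σ ++ [b])) ≤ ∑' τ : G b, w τ.1.length := by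
    intro b
    refine content_le ?_
    rintro x ⟨hxA, hx⟩
    have hxσ := cyl_subset_cyl (List.prefix_append σ [b]) hx
    obtain ⟨τ, hτF, hxτ⟩ := mem_iUnion₂.1 (hF ⟨hxA, hxσ⟩)
    refine mem_iUnion₂.2 ⟨τ, ⟨hτF, isPrefix_of_mem_cyl hx hxτ ?_⟩, hxτ⟩
    -- A string of the cover no longer than σ would alone weigh at least `w σ.length`, more than the
    -- whole cover.
    by_contra hlt
    have hle : τ.length ≤ σ.length := by simp at hlt; omega
    have h1 : w τ.length ≤ ∑' σ : F, w σ.1.length :=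
      ENNReal.le_tsum (f := fun σ : F => w σ.1.length) ⟨τ, hτF⟩
    exact absurd ((hw hle).trans h1) (not_le.2 hFc.2)
  have hdisj : Disjoint (G false) (G true) := by
    rw [Set.disjoint_left]
    rintro τ ⟨-, h0⟩ ⟨-, h1⟩
    have := (List.prefix_of_prefix_length_le h0 h1 (by simp)).eq_of_length (by simp)
    simp at this
  calc content w (A ∩ cyl (σ ++ [false])) + content w (A ∩ cyl (σ ++ [true]))
      ≤ ∑' τ : G false, w τ.1.length + ∑' τ : G true, w τ.1.length := add_le_add (hG _) (hG _)
    _ = ∑' τ : ↑(G false ∪ G true), w τ.1.length :=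
        (ENNReal.summable.tsum_union_disjoint (f := fun τ : List Bool => w τ.length) hdisj
          ENNReal.summable).symm
    _ ≤ ∑' σ : F, w σ.1.length :=
        ENNReal.tsum_mono_subtype (fun τ : List Bool => w τ.length)
          (union_subset (fun _ h => h.1) fun _ h => h.1)
    _ < c := hFc.1

theorem eq_or_append_isPrefix {ρ σ : List Bool} (h : ρ <+: σ) :
    ρ = σ ∨ ρ ++ [false] <+: σ ∨ ρ ++ [true] <+: σ := by
  obtain ⟨t, rfl⟩ := h
  rcases t with _ | ⟨b, t⟩
  · simp
  · cases b <;> simp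

/-- Iterates `content_split` down the tree from ρ. The strict inequality at proper prefixes of
members of G is what allows a split at each node above the antichain; d bounds the remaining depth.
-/
theorem sum_content_le_of_antichain (hw : Antitone w) (d : ℕ) :
    ∀ (ρ : List Bool) (G : Finset (List Bool)), (∀ σ ∈ G, σ.length ≤ ρ.length + d) →
      (∀ σ ∈ G, ρ <+: σ) → (∀ σ ∈ G, ∀ τ ∈ G, σ <+: τ → σ = τ) →
      (∀ σ ∈ G, ∀ π, π <+: σ → π ≠ σ → content w (A ∩ cyl π) < w π.length) →
      ∑ σ ∈ G, content w (A ∩ cyl σ) ≤ content w (A ∩ cyl ρ) := by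
  classical
  induction d with
  | zero =>
    intro ρ G hlen hpre _ _
    have : G ⊆ {ρ} := fun σ hσ => by
      simpa using ((hpre σ hσ).eq_of_length (le_antisymm (hpre σ hσ).length_le (hlen σ hσ))).symm
    exact (Finset.sum_le_sum_of_subset this).trans (by simp)
  | succ d ih =>
    intro ρ G hlen hpre hanti hlt
    by_cases hρ : ρ ∈ G
    · have : G ⊆ {ρ} := fun σ hσ => by
        simpa using (hanti ρ hρ σ hσ (hpre σ hσ)).symm
      exact (Finset.sum_le_sum_of_subset this).trans (by simp)
    rcases G.eq_empty_or_nonempty with rfl | ⟨σ₀, hσ₀⟩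
    · simp
    have hρlt := hlt σ₀ hσ₀ ρ (hpre σ₀ hσ₀) (fun h => hρ (h ▸ hσ₀))
    have hsub : G ⊆ G.filter (ρ ++ [false] <+: ·) ∪ G.filter (ρ ++ [true] <+: ·) := by
      intro σ hσ
      rcases eq_or_append_isPrefix (hpre σ hσ) with h | h | h
      · exact absurd (h ▸ hσ) hρ
      · simp [hσ, h]
      · simp [hσ, h]
    have key : ∀ b, ∑ σ ∈ G.filter (ρ ++ [b] <+: ·), content w (A ∩ cyl σ) ≤
        content w (A ∩ cyl (ρ ++ [b])) := by
      intro b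
      refine ih _ _ (fun σ hσ => ?_) (fun σ hσ => (Finset.mem_filter.1 hσ).2)
        (fun σ hσ τ hτ => hanti σ (Finset.mem_filter.1 hσ).1 τ (Finset.mem_filter.1 hτ).1)
        (fun σ hσ => hlt σ (Finset.mem_filter.1 hσ).1)
      have := hlen σ (Finset.mem_filter.1 hσ).1
      simp only [List.length_append, List.length_singleton]
      omega
    calc ∑ σ ∈ G, content w (A ∩ cyl σ)
        ≤ ∑ σ ∈ G.filter (ρ ++ [false] <+: ·) ∪ G.filter (ρ ++ [true] <+: ·),
            content w (A ∩ cyl σ) := Finset.sum_le_sum_of_subset hsub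
      _ ≤ ∑ σ ∈ G.filter (ρ ++ [false] <+: ·), content w (A ∩ cyl σ) +
            ∑ σ ∈ G.filter (ρ ++ [true] <+: ·), content w (A ∩ cyl σ) := by
          rw [← Finset.sum_union_inter]; exact le_self_add
      _ ≤ _ := (add_le_add (key false) (key true)).trans (content_split hw hρlt)

/-- A density theorem: almost every point of `A` lies in a cylinder in which the content of `A` is
at least the proportion `θ` of the weight of the cylinder. -/
theorem content_diff_dense_eq_zero (hfin : w 0 ≠ ∞) {θ δ : ℝ≥0∞} (hδ : δ ≠ 0)
    (hθ : θ + δ = 1) :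
    content w (A \ ⋃ σ ∈ {σ : List Bool | θ * w σ.length ≤ content w (A ∩ cyl σ)}, cyl σ) = 0 := by
  have hAfin : content w A ≠ ∞ :=
    ne_top_of_le_ne_top hfin (content_le_of_subset_cyl (σ := []) (by simp))
  have hδtop : δ ≠ ∞ := ne_top_of_le_ne_top ENNReal.one_ne_top (hθ ▸ le_add_self)
  set E := {σ : List Bool | θ * w σ.length ≤ content w (A ∩ cyl σ)} with hE
  suffices h : δ * content w (A \ ⋃ σ ∈ E, cyl σ) = 0 from (mul_eq_zero.1 h).resolve_left hδ
  refine le_antisymm (ENNReal.le_of_forall_pos_le_add fun ε hε _ => ?_) bot_le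
  rw [zero_add]
  obtain ⟨F, hF, hFs⟩ := exists_cover_of_content_lt
    (ENNReal.lt_add_right hAfin (ENNReal.coe_pos.2 hε).ne')
  have hsplit : ∑' σ : F, w σ.1.length =
      ∑' σ : ↑(F ∩ E), w σ.1.length + ∑' σ : ↑(F \ E), w σ.1.length := by
    conv_lhs => rw [← inter_union_sdiff F E]
    exact ENNReal.summable.tsum_union_disjoint (f := fun τ : List Bool => w τ.length)
      (disjoint_sdiff_right.mono_left inter_subset_right) ENNReal.summable
  have hA : A ⊆ (⋃ σ ∈ F ∩ E, A ∩ cyl σ) ∪ ⋃ σ ∈ F \ E, A ∩ cyl σ := by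
    intro x hx
    obtain ⟨σ, hσ, hxσ⟩ := mem_iUnion₂.1 (hF hx)
    by_cases hσE : σ ∈ E
    · exact Or.inl (mem_iUnion₂.2 ⟨σ, ⟨hσ, hσE⟩, hx, hxσ⟩)
    · exact Or.inr (mem_iUnion₂.2 ⟨σ, ⟨hσ, hσE⟩, hx, hxσ⟩)
  -- Strings outside E cover a part of A of content at most θ times their weight, so a cover that is
  -- optimal up to ε can spend at most ε/δ on them.
  have h1 : content w A ≤
      ∑' σ : ↑(F ∩ E), w σ.1.length + θ * ∑' σ : ↑(F \ E), w σ.1.length := by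
    refine (content_mono hA).trans (content_union_le.trans (add_le_add ?_ ?_))
    · exact (content_biUnion_le _ _).trans
        (ENNReal.tsum_le_tsum fun σ => content_le_of_subset_cyl inter_subset_right)
    · rw [← ENNReal.tsum_mul_left]
      exact (content_biUnion_le _ _).trans
        (ENNReal.tsum_le_tsum fun σ => (not_le.1 σ.2.2).le)
  have h2 : content w A + δ * ∑' σ : ↑(F \ E), w σ.1.length ≤ content w A + ε := by
    refine le_trans (add_le_add_left h1 _) ?_
    rw [add_assoc, ← add_mul, hθ, one_mul, ← hsplit]
    exact hFs.le
  refine le_trans ?_ ((ENNReal.add_le_add_iff_left hAfin).1 h2)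
  gcongr
  refine content_le ?_
  rintro x ⟨hx, hxE⟩
  obtain ⟨σ, hσ, hxσ⟩ := mem_iUnion₂.1 (hF hx)
  exact mem_iUnion₂.2 ⟨σ, ⟨hσ, fun h => hxE (mem_iUnion₂.2 ⟨σ, h, hxσ⟩)⟩, hxσ⟩

theorem exists_minimal_isPrefix {E : Set (List Bool)} {σ : List Bool} (h : σ ∈ E) :
    ∃ τ ∈ E, τ <+: σ ∧ ∀ π ∈ E, π <+: τ → π = τ := by
  induction hn : σ.length using Nat.strong_induction_on generalizing σ with
  | _ n ih =>
    by_cases hmin : ∀ π ∈ E, π <+: σ → π = σ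
    · exact ⟨σ, h, List.prefix_rfl, hmin⟩
    · push Not at hmin
      obtain ⟨π, hπ, hπσ, hne⟩ := hmin
      have hlt : π.length < n := by
        rw [← hn]
        exact lt_of_le_of_ne hπσ.length_le fun h => hne (hπσ.eq_of_length h)
      obtain ⟨τ, hτ, hτπ, hτm⟩ := ih _ hlt hπ rfl
      exact ⟨τ, hτ, hτπ.trans hπσ, hτm⟩

/-- The increasing sets lemma: the content is continuous along increasing unions of arbitrary
sets. -/
theorem content_iUnion_of_monotone (hw : Antitone w) (hfin : w 0 ≠ ∞)
    {A : ℕ → Set Cantor} (hA : Monotone A) : content w (⋃ n, A n) ≤ ⨆ n, content w (A n) := by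
  have key : ∀ θ : ℝ≥0∞, θ < 1 → θ * content w (⋃ n, A n) ≤ ⨆ n, content w (A n) := by
    intro θ hθ
    let E : ℕ → Set (List Bool) := fun n =>
      {σ | θ * w σ.length ≤ content w (A n ∩ cyl σ)}
    have hEmono : Monotone E := fun m n hmn σ hσ =>
      hσ.trans (content_mono (inter_subset_inter_left _ (hA hmn)))
    -- The minimal strings form an antichain and still cover the union up to a null set; any
    -- finitely many of them lie in a single `E n`.
    let M : Set (List Bool) := {τ | τ ∈ ⋃ n, E n ∧ ∀ π ∈ ⋃ n, E n, π <+: τ → π = τ}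
    have hnull : content w ((⋃ n, A n) \ ⋃ σ ∈ ⋃ n, E n, cyl σ) = 0 := by
      have hsub : (⋃ n, A n) \ ⋃ σ ∈ ⋃ n, E n, cyl σ ⊆ ⋃ n, A n \ ⋃ σ ∈ E n, cyl σ := by
        rintro x ⟨hx, hxE⟩
        obtain ⟨n, hn⟩ := mem_iUnion.1 hx
        refine mem_iUnion.2 ⟨n, hn, fun h => hxE ?_⟩
        exact biUnion_subset_biUnion_left (subset_iUnion E n) h
      refine le_antisymm ((content_mono hsub).trans (content_iUnion_null fun n => ?_).le) bot_le
      exact content_diff_dense_eq_zero hfin (tsub_pos_of_lt hθ).ne' (add_tsub_cancel_of_le hθ.le)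
    have hcov : (⋃ n, A n) ⊆ (⋃ σ ∈ M, cyl σ) ∪ ((⋃ n, A n) \ ⋃ σ ∈ ⋃ n, E n, cyl σ) := by
      intro x hx
      by_cases hxE : x ∈ ⋃ σ ∈ ⋃ n, E n, cyl σ
      · obtain ⟨σ, hσ, hxσ⟩ := mem_iUnion₂.1 hxE
        obtain ⟨τ, hτ, hτσ, hτm⟩ := exists_minimal_isPrefix hσ
        exact Or.inl (mem_iUnion₂.2 ⟨τ, ⟨hτ, hτm⟩, cyl_subset_cyl hτσ hxσ⟩)
      · exact Or.inr ⟨hx, hxE⟩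
    have hle : content w (⋃ n, A n) ≤ ∑' σ : M, w σ.1.length := by
      refine (content_mono hcov).trans (content_union_le.trans ?_)
      rw [hnull, add_zero]
      exact content_le Subset.rfl
    calc θ * content w (⋃ n, A n) ≤ θ * ∑' σ : M, w σ.1.length := by gcongr
      _ = ∑' σ : M, θ * w σ.1.length := ENNReal.tsum_mul_left.symm
      _ ≤ ⨆ n, content w (A n) := ?_
    rw [ENNReal.tsum_eq_iSup_sum]
    refine iSup_le fun G => ?_
    have hGn : ∃ n, ∀ σ ∈ G, σ.1 ∈ E n := by
      choose n hn using fun σ : M => mem_iUnion.1 σ.2.1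
      exact ⟨G.sup n, fun σ hσ => hEmono (Finset.le_sup hσ) (hn σ)⟩
    obtain ⟨n, hn⟩ := hGn
    refine le_trans ?_ (le_iSup _ n)
    have hanti := sum_content_le_of_antichain (A := A n) hw (G.sup fun σ => σ.1.length) []
      (G.map (Function.Embedding.subtype _)) ?_ (fun σ _ => List.nil_prefix) ?_ ?_
    · rw [Finset.sum_map, cyl_nil, inter_univ] at hanti
      exact (Finset.sum_le_sum fun σ hσ => hn σ hσ).trans hanti
    · intro σ hσ
      obtain ⟨τ, hτ, rfl⟩ := Finset.mem_map.1 hσ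
      simpa using Finset.le_sup (f := fun σ : M => σ.1.length) hτ
    · intro σ hσ τ hτ hστ
      obtain ⟨σ, -, rfl⟩ := Finset.mem_map.1 hσ
      obtain ⟨τ, -, rfl⟩ := Finset.mem_map.1 hτ
      exact τ.2.2 _ σ.2.1 hστ
    · intro σ hσ π hπ hne
      obtain ⟨σ, -, rfl⟩ := Finset.mem_map.1 hσ
      -- By minimality a proper prefix lies in no `E n`, so its content is below θ times its weight,
      -- as splitting requires.
      have hπE : π ∉ E n := fun h => hne (σ.2.2 π (mem_iUnion.2 ⟨n, h⟩) hπ)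
      refine (not_le.1 hπE).trans_le ?_
      exact (mul_le_mul_left hθ.le _).trans (one_mul _).le
  have hlim : Filter.Tendsto (fun θ : ℝ≥0∞ => θ * content w (⋃ n, A n)) (nhdsWithin 1 (Iio 1))
      (nhds (1 * content w (⋃ n, A n))) :=
    (ENNReal.Tendsto.mul_const Filter.tendsto_id (Or.inl one_ne_zero)).mono_left
      nhdsWithin_le_nhds
  rw [one_mul] at hlim
  have : (nhdsWithin (1 : ℝ≥0∞) (Iio 1)).NeBot :=
    nhdsLT_neBot_of_exists_lt ⟨0, zero_lt_one⟩
  exact le_of_tendsto hlim (Filter.eventually_of_mem self_mem_nhdsWithin key)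

end EffectiveCantor

/-! ### Null sets of the content and of Hausdorff measure -/

namespace EffectiveCantor

open Set
open scoped ENNReal NNReal

/-- The weight `2 ^ (-⌊p * n / q⌋)`, which is comparable with the `p / q`-th power of the diameter
of a cylinder over a string of length `n`. -/
noncomputable def weight (p q n : ℕ) : ℝ≥0∞ := 2⁻¹ ^ (p * n / q)

variable {p q : ℕ}

theorem weight_antitone (p q : ℕ) : Antitone (weight p q) := fun _ _ h =>
  pow_le_pow_right_of_le_one' (by simp)
    (Nat.div_le_div_right (Nat.mul_le_mul_left p h))

theorem weight_zero_ne_top (p q : ℕ) : weight p q 0 ≠ ∞ := by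
  simp [weight]

theorem rpow_le_weight (n : ℕ) :
    ((2⁻¹ : ℝ≥0∞) ^ n) ^ ((p : ℝ) / q) ≤ weight p q n := by
  rw [weight, ← ENNReal.rpow_natCast, ← ENNReal.rpow_natCast, ← ENNReal.rpow_mul]
  refine ENNReal.rpow_le_rpow_of_exponent_ge (by simp) ?_
  refine Nat.cast_div_le.trans_eq ?_
  push_cast
  ring

theorem weight_le_rpow (hq : 0 < q) (n : ℕ) :
    weight p q n ≤ 2 * ((2⁻¹ : ℝ≥0∞) ^ n) ^ ((p : ℝ) / q) := by
  have h1 : weight p q n = 2 * 2⁻¹ ^ (p * n / q + 1) := by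
    rw [pow_succ', ← mul_assoc, ENNReal.mul_inv_cancel two_ne_zero ENNReal.ofNat_ne_top, one_mul,
      weight]
  rw [h1, ← ENNReal.rpow_natCast, ← ENNReal.rpow_natCast, ← ENNReal.rpow_mul]
  gcongr 2 * ?_
  refine ENNReal.rpow_le_rpow_of_exponent_ge (by simp) ?_
  have hq' : (0 : ℝ) < q := by exact_mod_cast hq
  rw [mul_div_assoc', div_le_iff₀ hq']
  have := Nat.lt_mul_div_succ (p * n) hq
  calc (n : ℝ) * p = ((p * n : ℕ) : ℝ) := by push_cast; ring
    _ ≤ (((p * n / q + 1) * q : ℕ) : ℝ) := by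
        rw [mul_comm _ q]
        exact_mod_cast this.le
    _ = _ := by push_cast; ring

section Metric

attribute [local instance] PiNat.metricSpace

theorem edist_le_iff {x y : Cantor} {n : ℕ} :
    edist x y ≤ 2⁻¹ ^ n ↔ restrict x n = restrict y n := by
  have h : ((2⁻¹ : ℝ≥0∞) ^ n) = ENNReal.ofReal ((1 / 2) ^ n) := by
    rw [ENNReal.ofReal_pow (by norm_num), one_div, ENNReal.ofReal_inv_of_pos two_pos]
    simp
  rw [restrict_eq_iff, h, edist_dist, ENNReal.ofReal_le_ofReal_iff (by positivity)]
  exact PiNat.mem_cylinder_iff_dist_le.symm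

theorem ediam_cyl_le (σ : List Bool) : Metric.ediam (cyl σ) ≤ 2⁻¹ ^ σ.length :=
  Metric.ediam_le fun _ hx _ hy => edist_le_iff.2 (Eq.trans hx (Eq.symm hy))

/-- T lies in a cylinder of length N with 2^(-N) at most twice max(diam T, η). The parameter η
handles sets of diameter 0, for which no largest N exists. One factor 2 pays for the floor in the
weight, the other for 2^(p/q) ≤ 2. -/
theorem content_weight_le_ediam (hq : 0 < q) (hpq : p ≤ q) {T : Set Cantor} (hT : T.Nonempty)
    {η : ℝ≥0} (hη : 0 < η) (hη1 : η ≤ 1) :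
    content (weight p q) T ≤ 4 * (Metric.ediam T ^ ((p : ℝ) / q) + (η : ℝ≥0∞) ^ ((p : ℝ) / q)) := by
  obtain ⟨x, hx⟩ := hT
  have hs0 : 0 ≤ (p : ℝ) / q := by positivity
  have hs1 : (p : ℝ) / q ≤ 1 := div_le_one_of_le₀ (by exact_mod_cast hpq) (by positivity)
  have hdiam : Metric.ediam T ≤ 1 := Metric.ediam_le fun y _ z _ =>
    ((edist_le_iff (x := y) (y := z) (n := 0)).2 rfl).trans_eq (pow_zero _)
  obtain ⟨d, hd⟩ : ∃ d : ℝ≥0, (d : ℝ≥0∞) = Metric.ediam T :=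
    ⟨_, ENNReal.coe_toNNReal (ne_top_of_le_ne_top ENNReal.one_ne_top hdiam)⟩
  rw [← hd] at hdiam ⊢
  have hd1 : d ≤ 1 := by exact_mod_cast hdiam
  have hcoe : ∀ n : ℕ, (((2⁻¹ : ℝ≥0) ^ n : ℝ≥0) : ℝ≥0∞) = 2⁻¹ ^ n := fun n => by
    rw [ENNReal.coe_pow, ENNReal.coe_inv two_ne_zero, ENNReal.coe_ofNat]
  obtain ⟨N, hN1, hN2⟩ := exists_nat_pow_near_of_lt_one (x := max d η) (y := (2⁻¹ : ℝ≥0))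
    (lt_max_of_lt_right hη) (max_le hd1 hη1) (by norm_num) two_inv_lt_one
  have hsub : T ⊆ cyl (restrict x N) := by
    intro y hy
    have : edist y x ≤ 2⁻¹ ^ N := by
      refine (Metric.edist_le_ediam_of_mem hy hx).trans ?_
      rw [← hd, ← hcoe]
      exact ENNReal.coe_le_coe.2 ((le_max_left _ _).trans hN2)
    simpa [cyl] using edist_le_iff.1 this
  have h2y : (2⁻¹ : ℝ≥0∞) ^ N ≤ 2 * (max d η : ℝ≥0) := by
    have h1 : (2⁻¹ : ℝ≥0∞) ^ N = 2 * 2⁻¹ ^ (N + 1) := by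
      rw [pow_succ', ← mul_assoc, ENNReal.mul_inv_cancel two_ne_zero ENNReal.ofNat_ne_top, one_mul]
    rw [h1, ← hcoe]
    gcongr
  calc content (weight p q) T ≤ weight p q N := by
        simpa using content_le_of_subset_cyl (w := weight p q) hsub
    _ ≤ 2 * ((2⁻¹ : ℝ≥0∞) ^ N) ^ ((p : ℝ) / q) := weight_le_rpow hq N
    _ ≤ 2 * (2 * (max d η : ℝ≥0)) ^ ((p : ℝ) / q) := by gcongr
    _ = 2 * (2 ^ ((p : ℝ) / q) * (max d η : ℝ≥0) ^ ((p : ℝ) / q)) := by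
        rw [ENNReal.mul_rpow_of_nonneg _ _ hs0]
    _ ≤ 2 * (2 * ((d : ℝ≥0∞) ^ ((p : ℝ) / q) + (η : ℝ≥0∞) ^ ((p : ℝ) / q))) := by
        gcongr
        · simpa using ENNReal.rpow_le_rpow_of_exponent_le (x := 2) (by norm_num) hs1
        · rcases le_total d η with h | h
          · rw [max_eq_right h]; exact le_add_self
          · rw [max_eq_left h]; exact le_self_add
    _ = _ := by rw [← mul_assoc]; norm_num

theorem content_eq_zero_of_hausdorffMeasure (hp : 0 < p) (hq : 0 < q) (hpq : p ≤ q)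
    {A : Set Cantor} (h : MeasureTheory.Measure.hausdorffMeasure ((p : ℝ) / q) A = 0) :
    content (weight p q) A = 0 := by
  have hs : 0 < (p : ℝ) / q := by positivity
  rw [MeasureTheory.Measure.hausdorffMeasure_apply] at h
  -- Covers of mesh at most 1 suffice, since the content ignores mesh.
  have h1 := le_antisymm_iff.1 (ENNReal.iSup_eq_zero.1 (ENNReal.iSup_eq_zero.1 h 1) one_pos)
  refine le_antisymm (ENNReal.le_of_forall_pos_le_add fun ε hε _ => ?_) bot_le
  rw [zero_add]
  have hε8 : (0 : ℝ≥0∞) < ε / 8 := ENNReal.div_pos (ENNReal.coe_pos.2 hε).ne' (by norm_num)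
  obtain ⟨t, ht⟩ := iInf_lt_iff.1 (h1.1.trans_lt hε8)
  obtain ⟨hAt, ht⟩ := iInf_lt_iff.1 ht
  obtain ⟨-, ht⟩ := iInf_lt_iff.1 ht
  obtain ⟨δ, hδ, hsum⟩ := ENNReal.exists_pos_sum_of_countable hε8.ne' ℕ
  have hT : ∀ n, content (weight p q) (t n) ≤
      4 * ((⨆ _ : (t n).Nonempty, Metric.ediam (t n) ^ ((p : ℝ) / q)) + δ n) := by
    intro n
    rcases (t n).eq_empty_or_nonempty with he | hne
    · refine (content_le (F := ∅) (by simp [he])).trans ?_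
      simp
    · rw [iSup_pos hne]
      -- This η satisfies η^(p/q) ≤ δ n, so the errors are summable.
      refine (content_weight_le_ediam hq hpq hne (η := min 1 (δ n ^ ((p : ℝ) / q)⁻¹))
        (lt_min one_pos (NNReal.rpow_pos (hδ n))) (min_le_left _ _)).trans ?_
      gcongr
      rw [← ENNReal.coe_rpow_of_nonneg _ hs.le, ENNReal.coe_le_coe]
      refine (NNReal.rpow_le_rpow (min_le_right _ _) hs.le).trans ?_
      rw [← NNReal.rpow_mul, inv_mul_cancel₀ hs.ne', NNReal.rpow_one]
  calc content (weight p q) A ≤ ∑' n, content (weight p q) (t n) :=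
        (content_mono hAt).trans (content_iUnion_le t)
    _ ≤ ∑' n, 4 * ((⨆ _ : (t n).Nonempty, Metric.ediam (t n) ^ ((p : ℝ) / q)) + δ n) :=
        ENNReal.tsum_le_tsum hT
    _ ≤ 4 * (ε / 8 + ε / 8) := by
        rw [ENNReal.tsum_mul_left, ENNReal.tsum_add]
        gcongr
    _ = 8 * (ε / 8) := by rw [← two_mul, ← mul_assoc]; norm_num
    _ = ε := ENNReal.mul_div_cancel (by norm_num) (by norm_num)

theorem hausdorffMeasure_eq_zero_of_content (hp : 0 < p) (hq : 0 < q)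
    {A : Set Cantor} (h : content (weight p q) A = 0) :
    MeasureTheory.Measure.hausdorffMeasure ((p : ℝ) / q) A = 0 := by
  classical
  have hs : 0 < (p : ℝ) / q := by positivity
  have hpos : ∀ n, 0 < weight p q n := fun n => ENNReal.pow_pos (by simp) _
  -- Total weight below `weight p q n` forces every string to have length at least n, so the mesh
  -- tends to 0; the bound 2^(-n) sends the sums to 0.
  have hc : ∀ n : ℕ, ∃ F : Set (List Bool), A ⊆ ⋃ σ ∈ F, cyl σ ∧
      ∑' σ : F, weight p q σ.1.length < min (weight p q n) (2⁻¹ ^ n) := fun n =>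
    exists_cover_of_content_lt (h ▸ lt_min (hpos n) (ENNReal.pow_pos (by simp) _))
  choose F hF hFs using hc
  have hlen : ∀ n, ∀ σ ∈ F n, n ≤ σ.length := by
    intro n σ hσ
    by_contra hlt
    have h1 : weight p q σ.length ≤ ∑' σ : F n, weight p q σ.1.length :=
      ENNReal.le_tsum (f := fun σ : F n => weight p q σ.1.length) ⟨σ, hσ⟩
    exact absurd ((weight_antitone p q (not_le.1 hlt).le).trans h1)
      (not_le.2 ((hFs n).trans_le (min_le_left _ _)))
  have hr : Filter.Tendsto (fun n : ℕ => (2⁻¹ : ℝ≥0∞) ^ n) Filter.atTop (nhds 0) :=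
    ENNReal.tendsto_pow_atTop_nhds_zero_of_lt_one (by simp)
  have hle := MeasureTheory.Measure.hausdorffMeasure_le_liminf_tsum (ι := fun n => F n)
    ((p : ℝ) / q) A (fun n : ℕ => (2⁻¹ : ℝ≥0∞) ^ n) hr (fun n σ => cyl σ.1)
    (Filter.Eventually.of_forall fun n σ => (ediam_cyl_le σ.1).trans
      (pow_le_pow_right_of_le_one' (by simp) (hlen n σ.1 σ.2)))
    (Filter.Eventually.of_forall fun n => by
      have := hF n
      rwa [biUnion_eq_iUnion] at this)
  refine le_antisymm (hle.trans ?_) bot_le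
  rw [← hr.liminf_eq]
  refine Filter.liminf_le_liminf (Filter.Eventually.of_forall fun n => ?_)
  refine le_trans ?_ ((hFs n).le.trans (min_le_right _ _))
  exact ENNReal.tsum_le_tsum fun σ =>
    (ENNReal.rpow_le_rpow (ediam_cyl_le σ.1) hs.le).trans (rpow_le_weight _)

end Metric

theorem hausdorff_eq_zero_iff (hp : 0 < p) (hq : 0 < q) (hpq : p ≤ q) {A : Set Cantor} :
    hausdorff ((p : ℝ) / q) A = 0 ↔ content (weight p q) A = 0 :=
  ⟨content_eq_zero_of_hausdorffMeasure hp hq hpq, hausdorffMeasure_eq_zero_of_content hp hq⟩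

end EffectiveCantor

/-! ### Projections and the finite escape criterion -/

namespace EffectiveCantor

open Set
open scoped ENNReal

/-- The projection to Cantor space of the set of paths through `T`. -/
def proj (T : List Bool × List ℕ → Prop) : Set Cantor :=
  {x | ∃ g : ℕ → ℕ, ∀ n, T (restrict x n, restrict g n)}

/-- The projection to Cantor space of the set of paths `(x, g)` through `T` for which the initial
part of `g` is bounded by `u`. -/
def projBdd (T : List Bool × List ℕ → Prop) (u : List ℕ) : Set Cantor :=
  {x | ∃ g : ℕ → ℕ, (∀ i < u.length, g i ≤ u.getD i 0) ∧ ∀ n, T (restrict x n, restrict g n)}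

theorem projBdd_nil (T : List Bool × List ℕ → Prop) : projBdd T [] = proj T := by
  simp [projBdd, proj]

theorem iUnion_projBdd_append (T : List Bool × List ℕ → Prop) (u : List ℕ) :
    ⋃ N, projBdd T (u ++ [N]) = projBdd T u := by
  ext x
  simp only [mem_iUnion]
  constructor
  · rintro ⟨N, g, hg, hT⟩
    refine ⟨g, fun i hi => ?_, hT⟩
    have := hg i (by simp; omega)
    rwa [List.getD_append _ _ _ _ hi] at this
  · rintro ⟨g, hg, hT⟩
    refine ⟨g u.length, g, fun i hi => ?_, hT⟩
    rcases Nat.lt_or_ge i u.length with h | h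
    · rw [List.getD_append _ _ _ _ h]
      exact hg i h
    · obtain rfl : i = u.length := by simp at hi; omega
      simp

theorem monotone_projBdd_append (T : List Bool × List ℕ → Prop) (u : List ℕ) :
    Monotone fun N => projBdd T (u ++ [N]) := by
  rintro M N hMN x ⟨g, hg, hT⟩
  refine ⟨g, fun i hi => (hg i (by simpa using hi)).trans ?_, hT⟩
  rcases Nat.lt_or_ge i u.length with h | h
  · rw [List.getD_append _ _ _ _ h, List.getD_append _ _ _ _ h]
  · obtain rfl : i = u.length := by simp at hi; omega
    simpa using hMN

/-- Bounding one more coordinate of the witness by N gives sets increasing with N, so some N keeps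
the content above c. -/
theorem exists_content_projBdd_gt {w : ℕ → ℝ≥0∞} (hw : Antitone w) (hfin : w 0 ≠ ∞)
    {T : List Bool × List ℕ → Prop} {c : ℝ≥0∞} (h : c < content w (proj T)) :
    ∃ h : ℕ → ℕ, ∀ n, c < content w (projBdd T (restrict h n)) := by
  refine exists_forall_restrict (P := fun u => c < content w (projBdd T u)) ?_ fun u hu => ?_
  · rwa [projBdd_nil]
  · rw [← iUnion_projBdd_append] at hu
    exact lt_iSup_iff.1 (hu.trans_le
      (content_iUnion_of_monotone hw hfin (monotone_projBdd_append T u)))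

theorem content_le_list_sum {w : ℕ → ℝ≥0∞} :
    ∀ {F : List (List Bool)} {A : Set Cantor}, (∀ x ∈ A, ∃ σ ∈ F, x ∈ cyl σ) →
      content w A ≤ (F.map fun σ => w σ.length).sum := by
  intro F
  induction F with
  | nil =>
    intro A hA
    refine (content_le (F := ∅) fun x hx => ?_).trans (by simp)
    simpa using hA x hx
  | cons σ F ih =>
    intro A hA
    have hsub : A ⊆ (A ∩ cyl σ) ∪ (A \ cyl σ) := by rw [inter_union_sdiff]
    rw [List.map_cons, List.sum_cons]
    refine (content_mono hsub).trans (content_union_le.trans (add_le_add ?_ (ih ?_)))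
    · exact content_le_of_subset_cyl inter_subset_right
    · rintro x ⟨hx, hxσ⟩
      obtain ⟨τ, hτ, hxτ⟩ := hA x hx
      rcases List.mem_cons.1 hτ with rfl | h
      · exact absurd hxτ hxσ
      · exact ⟨τ, h, hxτ⟩

variable {p q : ℕ}

/-- The total weight of the strings in `F`, multiplied by `2 ^ m` and with each summand rounded up
to an integer. -/
def scaledWeight (p q : ℕ) (F : List (List Bool)) (m : ℕ) : ℕ :=
  (F.map fun σ => 2 ^ (m - p * σ.length / q)).sum

theorem two_pow_mul_inv_pow (n : ℕ) : (2 : ℝ≥0∞) ^ n * 2⁻¹ ^ n = 1 := by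
  rw [← mul_pow, ENNReal.mul_inv_cancel two_ne_zero ENNReal.ofNat_ne_top, one_pow]

/-- Truncated subtraction only rounds up: a string whose exponent exceeds m counts as 1. Equality
needs m to dominate all exponents. -/
theorem sum_weight_le_scaledWeight (F : List (List Bool)) (m : ℕ) :
    2 ^ m * (F.map fun σ => weight p q σ.length).sum ≤ (scaledWeight p q F m : ℝ≥0∞) := by
  induction F with
  | nil => simp [scaledWeight]
  | cons σ F ih =>
    simp only [scaledWeight, List.map_cons, List.sum_cons, mul_add, Nat.cast_add] at ih ⊢
    refine add_le_add ?_ ih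
    push_cast
    calc (2 : ℝ≥0∞) ^ m * weight p q σ.length
        ≤ 2 ^ (m - p * σ.length / q + p * σ.length / q) * weight p q σ.length := by
          gcongr
          · norm_num
          · omega
      _ = 2 ^ (m - p * σ.length / q) := by
          rw [pow_add, mul_assoc, weight, two_pow_mul_inv_pow, mul_one]

theorem scaledWeight_eq {F : List (List Bool)} {m : ℕ}
    (h : ∀ σ ∈ F, p * σ.length / q ≤ m) :
    (scaledWeight p q F m : ℝ≥0∞) = 2 ^ m * (F.map fun σ => weight p q σ.length).sum := by
  induction F with
  | nil => simp [scaledWeight]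
  | cons σ F ih =>
    have ih := ih fun τ hτ => h τ (List.mem_cons_of_mem _ hτ)
    have hσ := h σ List.mem_cons_self
    simp only [scaledWeight, List.map_cons, List.sum_cons, mul_add, Nat.cast_add] at ih ⊢
    rw [ih]
    congr 1
    push_cast
    conv_rhs => rw [← Nat.sub_add_cancel hσ, pow_add, mul_assoc, weight, two_pow_mul_inv_pow,
      mul_one]

theorem sum_weight_le_of_scaledWeight {F : List (List Bool)} {m j : ℕ}
    (h : scaledWeight p q F m * 2 ^ j ≤ 2 ^ m) :
    (F.map fun σ => weight p q σ.length).sum ≤ 2⁻¹ ^ j := by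
  have h1 : (scaledWeight p q F m : ℝ≥0∞) * 2 ^ j ≤ 2 ^ m := by exact_mod_cast h
  set S := (F.map fun σ => weight p q σ.length).sum
  calc S = (2 ^ m * S * 2 ^ j) * (2⁻¹ ^ j * 2⁻¹ ^ m) := by
        rw [show 2 ^ m * S * 2 ^ j * (2⁻¹ ^ j * 2⁻¹ ^ m)
          = (2 ^ m * 2⁻¹ ^ m) * (2 ^ j * 2⁻¹ ^ j) * S by ring]
        simp [two_pow_mul_inv_pow]
    _ ≤ 2 ^ m * (2⁻¹ ^ j * 2⁻¹ ^ m) := by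
        gcongr
        exact (mul_le_mul_left (sum_weight_le_scaledWeight F m) _).trans h1
    _ = 2⁻¹ ^ j := by
        rw [show (2 : ℝ≥0∞) ^ m * (2⁻¹ ^ j * 2⁻¹ ^ m) = (2 ^ m * 2⁻¹ ^ m) * 2⁻¹ ^ j by ring,
          two_pow_mul_inv_pow, one_mul]

theorem scaledWeight_le_of_sum_weight {F : List (List Bool)} {m j : ℕ}
    (hm : ∀ σ ∈ F, p * σ.length / q ≤ m)
    (h : (F.map fun σ => weight p q σ.length).sum ≤ 2⁻¹ ^ j) :
    scaledWeight p q F m * 2 ^ j ≤ 2 ^ m := by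
  have h1 : (scaledWeight p q F m : ℝ≥0∞) * 2 ^ j ≤ 2 ^ m := by
    rw [scaledWeight_eq hm]
    calc (2 : ℝ≥0∞) ^ m * (F.map fun σ => weight p q σ.length).sum * 2 ^ j
        ≤ 2 ^ m * 2⁻¹ ^ j * 2 ^ j := by gcongr
      _ = 2 ^ m := by rw [mul_assoc, mul_comm (2⁻¹ ^ j), two_pow_mul_inv_pow, mul_one]
  exact_mod_cast h1

/-- The pair `z` of finite strings, continued by zeros, stays within `T` and the bound `h` up to
level `m` and avoids the cylinders over strings in `F`. -/
def Escapes (T : List Bool × List ℕ → Prop) (h : ℕ → ℕ) (F : List (List Bool)) (m : ℕ)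
    (z : List Bool × List ℕ) : Prop :=
  (∀ i < m, z.2.getD i 0 ≤ h i) ∧
    (∀ i ≤ m, T (restrict (z.1.getD · false) i, restrict (z.2.getD · 0) i)) ∧
    ∀ ρ ∈ F, restrict (z.1.getD · false) ρ.length ≠ ρ

theorem exists_escapes_of_not_covered {T : List Bool × List ℕ → Prop} {h : ℕ → ℕ}
    {F : List (List Bool)} {m : ℕ} {x : Cantor} (hx : x ∈ projBdd T (restrict h m))
    (hF : ∀ σ ∈ F, x ∉ cyl σ) : ∃ z, Escapes T h F m z := by
  obtain ⟨g, hg, hT⟩ := hx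
  -- Long enough that the padding is never consulted, either up to level m or by a string of F.
  let N := m + (F.map List.length).sum
  have hx : ∀ i ≤ N, restrict ((restrict x N).getD · false) i = restrict x i := fun i hi =>
    restrict_eq_iff.2 fun l hl => getD_restrict (hl.trans_le hi) _
  have hg' : ∀ i ≤ N, restrict ((restrict g N).getD · 0) i = restrict g i := fun i hi =>
    restrict_eq_iff.2 fun l hl => getD_restrict (hl.trans_le hi) _
  refine ⟨(restrict x N, restrict g N), fun i hi => ?_, fun i hi => ?_, fun ρ hρ => ?_⟩
  · have := hg i (by simpa using hi)
    rw [getD_restrict hi] at this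
    rwa [getD_restrict (by omega)]
  · rw [hx i (by omega), hg' i (by omega)]
    exact hT i
  · have : ρ.length ≤ N := le_add_left (List.le_sum_of_mem (List.mem_map_of_mem hρ))
    rw [hx _ this]
    exact hF ρ hρ

theorem eventually_restrict_eq {α : Type} [TopologicalSpace α] [DiscreteTopology α]
    {y : ℕ → ℕ → α} {x : ℕ → α} (h : Filter.Tendsto y Filter.atTop (nhds x)) (n : ℕ) :
    ∀ᶠ j in Filter.atTop, restrict (y j) n = restrict x n := by
  have h1 : ∀ i, ∀ᶠ j in Filter.atTop, y j i = x i := fun i => by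
    have := (tendsto_pi_nhds.1 h) i
    rw [nhds_discrete] at this
    exact Filter.tendsto_pure.1 this
  have h2 := (Filter.eventually_all_finset (Finset.range n)).2 fun i _ => h1 i
  filter_upwards [h2] with j hj
  exact restrict_eq_iff.2 fun i hi => hj i (Finset.mem_range.2 hi)

/-- The compactness argument: limits of pairs escaping larger and larger finite parts of `F` give a
point of the projection which is not covered by `F`. -/
theorem exists_mem_proj_of_escapes {T : List Bool × List ℕ → Prop} {h : ℕ → ℕ}
    {F : ℕ → List (List Bool)} (hF : ∀ n, ∃ m ≥ n, ∃ z, Escapes T h (F n) m z) :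
    ∃ x ∈ proj T, ∀ σ, (∀ᶠ n in Filter.atTop, σ ∈ F n) → x ∉ cyl σ := by
  choose m hm z hz using hF
  -- Truncating by h puts the sequence in a compact product and changes nothing below level m.
  let y : ℕ → Cantor × (ℕ → ℕ) := fun n =>
    (fun i => (z n).1.getD i false, fun i => min ((z n).2.getD i 0) (h i))
  have hcomp : IsCompact ((univ : Set Cantor) ×ˢ (Set.pi univ fun i => Iic (h i))) :=
    isCompact_univ.prod (isCompact_univ_pi fun i => (finite_Iic (h i)).isCompact)
  obtain ⟨⟨x, g⟩, -, φ, hφ, hlim⟩ := hcomp.tendsto_subseq (x := y) fun n =>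
    ⟨mem_univ _, fun i _ => mem_Iic.2 (min_le_right _ _)⟩
  have hx := (continuous_fst.tendsto _).comp hlim
  have hg := (continuous_snd.tendsto _).comp hlim
  refine ⟨x, ⟨g, fun n => ?_⟩, fun σ hσ hxσ => ?_⟩
  · obtain ⟨j, h1, h2, h3⟩ := ((eventually_restrict_eq hx n).and ((eventually_restrict_eq hg n).and
      (hφ.tendsto_atTop.eventually_ge_atTop n))).exists
    have hnm : n ≤ m (φ j) := h3.trans (hm _)
    have hT := (hz (φ j)).2.1 n hnm
    have h4 : restrict ((z (φ j)).2.getD · 0) n = restrict g n := by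
      rw [← h2]
      exact restrict_eq_iff.2 fun i hi =>
        (min_eq_left ((hz (φ j)).1 i (hi.trans_le hnm))).symm
    rw [← h1, ← h4]
    exact hT
  · obtain ⟨j, h1, h2⟩ := ((eventually_restrict_eq hx σ.length).and
      (hφ.tendsto_atTop.eventually hσ)).exists
    exact (hz (φ j)).2.2 σ h2 (h1.trans hxσ)

/-- Forward, a light F cannot cover the bounded part of the projection, and an uncovered point
yields z. Backward, a light countable cover has light finite parts; the pairs escaping them
accumulate at an uncovered point of the projection. -/
theorem content_proj_ne_zero_iff {T : List Bool × List ℕ → Prop} :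
    content (weight p q) (proj T) ≠ 0 ↔ ∃ h : ℕ → ℕ, ∀ F m,
      scaledWeight p q F m * 2 ^ h 0 ≤ 2 ^ m → ∃ z, Escapes T h F m z := by
  classical
  constructor
  · intro hpos
    obtain ⟨j, hj⟩ := ENNReal.exists_inv_two_pow_lt hpos
    obtain ⟨h, hh⟩ := exists_content_projBdd_gt (weight_antitone p q) (weight_zero_ne_top p q) hj
    -- The value at 0 serves both as a bound on the witness and as the exponent of the weight
    -- threshold, hence the maximum.
    refine ⟨fun i => max (h i) j, fun F m hFm => ?_⟩
    have hsum := sum_weight_le_of_scaledWeight hFm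
    obtain ⟨x, hx, hxF⟩ : ∃ x ∈ projBdd T (restrict h m), ∀ σ ∈ F, x ∉ cyl σ := by
      by_contra! hcon
      refine absurd (hh m) (not_lt.2 ((content_le_list_sum hcon).trans (hsum.trans ?_)))
      exact pow_le_pow_right_of_le_one' (by simp) (le_max_right _ _)
    obtain ⟨z, hz1, hz2⟩ := exists_escapes_of_not_covered hx hxF
    exact ⟨z, fun i hi => (hz1 i hi).trans (le_max_left _ _), hz2⟩
  · rintro ⟨h, hh⟩ hzero
    obtain ⟨F, hF, hFs⟩ := exists_cover_of_content_lt
      (hzero ▸ ENNReal.pow_pos (by simp) (h 0) : content (weight p q) (proj T) < 2⁻¹ ^ h 0)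
    let G : ℕ → Finset (List Bool) := fun n =>
      ((Finset.range n).preimage Encodable.encode Encodable.encode_injective.injOn).filter (· ∈ F)
    have hG : ∀ n, ∃ m ≥ n, ∃ z, Escapes T h (G n).toList m z := by
      intro n
      -- Large enough for the scaled weight of `G n` to be exact.
      let m := n + (G n).sup fun σ => p * σ.length / q
      refine ⟨m, Nat.le_add_right _ _, hh _ _ (scaledWeight_le_of_sum_weight (fun σ hσ => ?_) ?_)⟩
      · exact le_add_left (Finset.le_sup (f := fun σ : List Bool => p * σ.length / q)
          (Finset.mem_toList.1 hσ))
      · rw [Finset.sum_map_toList, ← Finset.tsum_subtype]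
        refine le_trans ?_ hFs.le
        exact ENNReal.tsum_mono_subtype (fun τ : List Bool => weight p q τ.length)
          fun σ hσ => (Finset.mem_filter.1 hσ).2
    obtain ⟨x, hx, hxG⟩ := exists_mem_proj_of_escapes hG
    obtain ⟨σ, hσ, hxσ⟩ := mem_iUnion₂.1 (hF hx)
    refine hxG σ ?_ hxσ
    filter_upwards [Filter.eventually_gt_atTop (Encodable.encode σ)] with n hn
    simp [G, hσ, hn]

end EffectiveCantor

/-! ### Computability of the criterion -/

namespace EffectiveCantor

open Set

theorem primrec_list_sum : Primrec (List.sum : List ℕ → ℕ) :=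
  Primrec.list_foldr Primrec.id (Primrec.const 0)
    (Primrec.nat_add.comp (Primrec.fst.comp Primrec.snd) (Primrec.snd.comp Primrec.snd)).to₂

theorem primrec_two_pow : Primrec fun n : ℕ => 2 ^ n :=
  (Primrec.nat_rec₁ 1 (Primrec.nat_mul.comp Primrec.snd (Primrec.const 2)).to₂).of_eq fun n => by
    induction n with
    | zero => rfl
    | succ n ih => simp only [pow_succ, ← ih]

theorem primrec_scaledWeight (p q : ℕ) : Primrec₂ (scaledWeight p q) := by
  refine primrec_list_sum.comp (Primrec.list_map Primrec.fst ?_)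
  refine primrec_two_pow.comp (Primrec.nat_sub.comp (Primrec.snd.comp Primrec.fst) ?_)
  exact Primrec.nat_div.comp (Primrec.nat_mul.comp (Primrec.const p)
    (Primrec.list_length.comp Primrec.snd)) (Primrec.const q)

theorem primrec_restrict_getD {α : Type} [Primcodable α] (d : α) :
    Primrec₂ fun (l : List α) n => restrict (l.getD · d) n :=
  Primrec.list_map (Primrec.list_range.comp Primrec.snd)
    ((Primrec.list_getD d).comp (Primrec.fst.comp Primrec.fst) Primrec.snd)

/-- The matrix of the definition of the set of those `k` for which the projection of the tree
`{z | ∀ t, ¬ Q (k, z, t)}` has non-zero content. -/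
def escapeMatrix (p q : ℕ) (Q : ℕ × (List Bool × List ℕ) × ℕ → Prop)
    (k : ℕ) (h : ℕ → ℕ) (F : List (List Bool)) (m : ℕ) (z : List Bool × List ℕ) (i t : ℕ) : Prop :=
  ¬ scaledWeight p q F m * 2 ^ h 0 ≤ 2 ^ m ∨
    ((¬ i < m ∨ z.2.getD i 0 ≤ h i) ∧
      (¬ i ≤ m ∨ ¬ Q (k, (restrict (z.1.getD · false) i, restrict (z.2.getD · 0) i), t)) ∧
      ∀ ρ ∈ F, restrict (z.1.getD · false) ρ.length ≠ ρ)

/-- Records the finite use of h, so that an initial segment of h decides the matrix. -/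
theorem escapeMatrix_congr {p q : ℕ} {Q : ℕ × (List Bool × List ℕ) × ℕ → Prop} {k : ℕ}
    {h h' : ℕ → ℕ} {F : List (List Bool)} {m : ℕ} {z : List Bool × List ℕ} {i t : ℕ}
    (h0 : h 0 = h' 0) (hi : i < m → h i = h' i) :
    escapeMatrix p q Q k h F m z i t ↔ escapeMatrix p q Q k h' F m z i t := by
  unfold escapeMatrix
  rw [h0]
  by_cases him : i < m
  · rw [hi him]
  · simp [him]

theorem forall_escapeMatrix_iff {p q : ℕ} {Q : ℕ × (List Bool × List ℕ) × ℕ → Prop} {k : ℕ}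
    {h : ℕ → ℕ} {F : List (List Bool)} {m : ℕ} {z : List Bool × List ℕ} :
    (∀ i t, escapeMatrix p q Q k h F m z i t) ↔
      (scaledWeight p q F m * 2 ^ h 0 ≤ 2 ^ m → Escapes (fun z => ∀ t, ¬ Q (k, z, t)) h F m z) := by
  unfold escapeMatrix Escapes
  constructor
  · intro H hw
    have H' := fun i t => (H i t).resolve_left (not_not.2 hw)
    exact ⟨fun i hi => (H' i 0).1.resolve_left (not_not.2 hi),
      fun i hi t => (H' i t).2.1.resolve_left (not_not.2 hi), (H' 0 0).2.2⟩
  · intro H i t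
    by_cases hw : scaledWeight p q F m * 2 ^ h 0 ≤ 2 ^ m
    · obtain ⟨h1, h2, h3⟩ := H hw
      refine Or.inr ⟨?_, ?_, h3⟩
      · by_cases hi : i < m
        · exact Or.inr (h1 i hi)
        · exact Or.inl hi
      · by_cases hi : i ≤ m
        · exact Or.inr (h2 i hi t)
        · exact Or.inl hi
    · exact Or.inl hw

theorem primrecPred_escapeMatrix (p q : ℕ) {Q : ℕ × (List Bool × List ℕ) × ℕ → Prop}
    (hQ : PrimrecPred Q) {β : Type} [Primcodable β] {k : β → ℕ} {h : β → ℕ → ℕ}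
    {F : β → List (List Bool)} {m : β → ℕ} {z : β → List Bool × List ℕ} {i t : β → ℕ}
    (hk : Primrec k) (hh : Primrec₂ h) (hF : Primrec F) (hm : Primrec m) (hz : Primrec z)
    (hi : Primrec i) (ht : Primrec t) :
    PrimrecPred fun b => escapeMatrix p q Q (k b) (h b) (F b) (m b) (z b) (i b) (t b) := by
  have hz1 := Primrec.fst.comp hz
  have hz2 := Primrec.snd.comp hz
  refine (Primrec.nat_le.comp (Primrec.nat_mul.comp ((primrec_scaledWeight p q).comp hF hm)
    (primrec_two_pow.comp (hh.comp Primrec.id (Primrec.const 0))))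
    (primrec_two_pow.comp hm)).not.or (PrimrecPred.and ?_ (PrimrecPred.and ?_ ?_))
  · exact (Primrec.nat_lt.comp hi hm).not.or
      (Primrec.nat_le.comp ((Primrec.list_getD 0).comp hz2 hi) (hh.comp Primrec.id hi))
  · exact (Primrec.nat_le.comp hi hm).not.or (hQ.comp (Primrec.pair hk (Primrec.pair (Primrec.pair
      ((primrec_restrict_getD false).comp hz1 hi) ((primrec_restrict_getD 0).comp hz2 hi)) ht))).not
  · have hrel : PrimrecRel fun (ρ : List Bool) (σ : List Bool) =>
        restrict (σ.getD · false) ρ.length ≠ ρ :=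
      (Primrec.eq.comp ((primrec_restrict_getD false).comp Primrec.snd
        (Primrec.list_length.comp Primrec.fst)) Primrec.fst).not
    exact hrel.forall_mem_list.comp hF hz1

theorem primrec_decode_getD {α : Type} [Primcodable α] [Inhabited α] :
    Primrec fun n : ℕ => (Encodable.decode n : Option α).getD default :=
  Primrec.option_getD.comp Primrec.decode (Primrec.const default)

/-- The finite object coded by a natural number. -/
abbrev decodeD (α : Type) [Primcodable α] [Inhabited α] (n : ℕ) : α :=
  (Encodable.decode n : Option α).getD default

/-- Skolemization: f a packs h a together with a code of the pair z chosen for the (F, m) coded by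
a, and n codes ((F, m), (i, t)). Unpairing does not increase numbers, so instance n consults f only
at arguments at most n. -/
theorem isSigma11_content_proj (p q : ℕ) {Q : ℕ × (List Bool × List ℕ) × ℕ → Prop}
    (hQ : PrimrecPred Q) :
    IsSigma11 {k | content (weight p q) (proj fun z => ∀ t, ¬ Q (k, z, t)) ≠ 0} := by
  let M : ℕ → (ℕ → ℕ) → ℕ → Prop := fun k f n =>
    escapeMatrix p q Q k (fun i => (f i).unpair.1) (decodeD _ n.unpair.1.unpair.1)
      n.unpair.1.unpair.2 (decodeD _ (f n.unpair.1).unpair.2) n.unpair.2.unpair.1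
      n.unpair.2.unpair.2
  have hM : ∀ k f n, M k f n ↔ M k ((restrict f (n + 1)).getD · 0) n := by
    intro k f n
    have hr : ∀ i ≤ n, (restrict f (n + 1)).getD i 0 = f i := fun i hi =>
      getD_restrict (Nat.lt_succ_of_le hi) 0
    have ha : n.unpair.1 ≤ n := Nat.unpair_left_le n
    simp only [M]
    rw [hr _ ha]
    refine escapeMatrix_congr ?_ fun hi => ?_
    · rw [hr 0 (Nat.zero_le n)]
    · rw [hr _ (hi.le.trans ((Nat.unpair_right_le _).trans ha))]
  -- A string of length n + 1 tests instance n; the empty string tests nothing.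
  refine ⟨fun b => b.2.length = 0 ∨ M b.1 (b.2.getD · 0) (b.2.length - 1), ?_, fun k => ?_⟩
  · have hn : Primrec fun b : ℕ × List ℕ => b.2.length - 1 :=
      Primrec.nat_sub.comp (Primrec.list_length.comp Primrec.snd) (Primrec.const 1)
    have hl : Primrec fun b : ℕ × List ℕ => (b.2.length - 1).unpair.1 :=
      Primrec.fst.comp (Primrec.unpair.comp hn)
    have hr : Primrec fun b : ℕ × List ℕ => (b.2.length - 1).unpair.2 :=
      Primrec.snd.comp (Primrec.unpair.comp hn)
    refine (PrimrecPred.or (Primrec.eq.comp (Primrec.list_length.comp Primrec.snd)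
      (Primrec.const 0)) ?_).computablePred
    refine primrecPred_escapeMatrix p q hQ Primrec.fst ?_ ?_ ?_ ?_ ?_ ?_
    · exact Primrec.fst.comp (Primrec.unpair.comp ((Primrec.list_getD 0).comp
        (Primrec.snd.comp Primrec.fst) Primrec.snd))
    · exact primrec_decode_getD.comp (Primrec.fst.comp (Primrec.unpair.comp hl))
    · exact Primrec.snd.comp (Primrec.unpair.comp hl)
    · exact primrec_decode_getD.comp (Primrec.snd.comp (Primrec.unpair.comp
        ((Primrec.list_getD 0).comp Primrec.snd hl)))
    · exact Primrec.fst.comp (Primrec.unpair.comp hr)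
    · exact Primrec.snd.comp (Primrec.unpair.comp hr)
  · have hf : ∀ f : ℕ → ℕ, (∀ n, (restrict f n).length = 0 ∨
        M k ((restrict f n).getD · 0) ((restrict f n).length - 1)) ↔ ∀ n, M k f n := by
      intro f
      refine ⟨fun H n => (hM k f n).2 ?_, fun H n => ?_⟩
      · simpa using H (n + 1)
      · rcases n with _ | n
        · simp
        · exact Or.inr (by simpa using (hM k f n).1 (H n))
    simp only [hf]
    rw [mem_ofPred_eq, content_proj_ne_zero_iff]
    constructor
    · rintro ⟨h, hh⟩
      have hz : ∀ a : ℕ, ∃ z, ∀ i t,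
          escapeMatrix p q Q k h (decodeD _ a.unpair.1) a.unpair.2 z i t := by
        intro a
        by_cases hw : scaledWeight p q (decodeD _ a.unpair.1) a.unpair.2 * 2 ^ h 0 ≤ 2 ^ a.unpair.2
        · obtain ⟨z, hz⟩ := hh _ _ hw
          exact ⟨z, forall_escapeMatrix_iff.2 fun _ => hz⟩
        · exact ⟨default, fun i t => Or.inl hw⟩
      choose v hv using hz
      refine ⟨fun a => Nat.pair (h a) (Encodable.encode (v a)), fun n => ?_⟩
      simp only [M, Nat.unpair_pair, decodeD, Encodable.encodek, Option.getD_some]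
      exact hv _ _ _
    · rintro ⟨f, H⟩
      refine ⟨fun i => (f i).unpair.1, fun F m hw => ?_⟩
      refine ⟨decodeD _ (f (Nat.pair (Encodable.encode F) m)).unpair.2,
        forall_escapeMatrix_iff.1 (fun i t => ?_) hw⟩
      have := H (Nat.pair (Nat.pair (Encodable.encode F) m) (Nat.pair i t))
      simpa only [M, Nat.unpair_pair, decodeD, Encodable.encodek, Option.getD_some] using this

/-! ### The two index sets are Σ¹₁ -/

open Nat.Partrec (Code)

/-- The number `n` is enumerated into the `e`-th computably enumerable set by stage `t`. -/
def EnumBy (e n t : ℕ) : Prop :=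
  (Nat.Partrec.Code.evaln t (Denumerable.ofNat Code e) n).isSome

theorem mem_ceSet_iff {e n : ℕ} : n ∈ ceSet e ↔ ∃ t, EnumBy e n t := by
  simp only [ceSet, mem_ofPred_eq, EnumBy, Part.dom_iff_mem, Nat.Partrec.Code.evaln_complete,
    Option.isSome_iff_exists, Option.mem_def]
  exact exists_comm

theorem primrecPred_enumBy {β : Type} [Primcodable β] {e n t : β → ℕ} (he : Primrec e)
    (hn : Primrec n) (ht : Primrec t) : PrimrecPred fun b => EnumBy (e b) (n b) (t b) := by
  have h : Primrec fun b =>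
      (Nat.Partrec.Code.evaln (t b) (Denumerable.ofNat Code (e b)) (n b)).isSome :=
    Primrec.option_isSome.comp (Nat.Partrec.Code.primrec_evaln.comp
      (Primrec.pair (Primrec.pair ht ((Primrec.ofNat Code).comp he)) hn))
  exact ⟨fun b => inferInstanceAs (Decidable (_ = true)),
    h.of_eq fun b => (Bool.decide_coe _).symm⟩

theorem sigma11Class_eq_proj (e : ℕ) :
    sigma11Class e = proj fun z => ∀ t, ¬ EnumBy e (Encodable.encode z) t := by
  ext x
  simp only [sigma11Class, proj, mem_ofPred_eq, mem_ceSet_iff, not_exists]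

/-- The string `z.1` does not have the prefix which `z.2` claims to witness membership in the
`t`-th open set of the `e`-th `Π⁰₂` class. -/
def Refutes (e : ℕ) (z : List Bool × List ℕ) (t : ℕ) : Prop :=
  t < z.2.length ∧ (z.2.getD t 0).unpair.1 ≤ z.1.length ∧
    ¬ EnumBy e (Encodable.encode (t, z.1.take (z.2.getD t 0).unpair.1)) (z.2.getD t 0).unpair.2

/-- The witness g t codes a prefix length together with a stage by which that prefix is enumerated
for t, which leaves a closed condition on (x, g). -/
theorem pi02Class_eq_proj (e : ℕ) : pi02Class e = proj fun z => ∀ t, ¬ Refutes e z t := by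
  ext x
  simp only [pi02Class, proj, mem_ofPred_eq, mem_ceSet_iff, Refutes, length_restrict]
  constructor
  · intro H
    choose m u hu using H
    refine ⟨fun n => Nat.pair (m n) (u n), fun n t ⟨h1, h2, h3⟩ => h3 ?_⟩
    rw [getD_restrict h1, Nat.unpair_pair] at h2 ⊢
    rw [take_restrict x h2]
    exact hu t
  · rintro ⟨g, hg⟩ t
    refine ⟨(g t).unpair.1, (g t).unpair.2, ?_⟩
    -- At this level both entry t of g and the claimed prefix of x are visible.
    have h := hg (t + 1 + (g t).unpair.1) t
    rw [getD_restrict (by omega), take_restrict x (by omega)] at h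
    by_contra hcon
    exact h ⟨by omega, by omega, hcon⟩

variable {p q : ℕ}

theorem isSigma11_sigma11Class (hp : 0 < p) (hq : 0 < q) (hpq : p ≤ q) :
    IsSigma11 {e | hausdorff ((p : ℝ) / q) (sigma11Class e) ≠ 0} := by
  simp only [ne_eq, hausdorff_eq_zero_iff hp hq hpq, sigma11Class_eq_proj]
  exact isSigma11_content_proj p q (Q := fun b => EnumBy b.1 (Encodable.encode b.2.1) b.2.2)
    (primrecPred_enumBy Primrec.fst (Primrec.encode.comp (Primrec.fst.comp Primrec.snd))
      (Primrec.snd.comp Primrec.snd))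

theorem isSigma11_pi02Class (hp : 0 < p) (hq : 0 < q) (hpq : p ≤ q) :
    IsSigma11 {e | hausdorff ((p : ℝ) / q) (pi02Class e) ≠ 0} := by
  simp only [ne_eq, hausdorff_eq_zero_iff hp hq hpq, pi02Class_eq_proj]
  refine isSigma11_content_proj p q (Q := fun b => Refutes b.1 b.2.1 b.2.2) ?_
  have hσ : Primrec fun b : ℕ × (List Bool × List ℕ) × ℕ => b.2.1.1 :=
    Primrec.fst.comp (Primrec.fst.comp Primrec.snd)
  have hτ : Primrec fun b : ℕ × (List Bool × List ℕ) × ℕ => b.2.1.2 :=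
    Primrec.snd.comp (Primrec.fst.comp Primrec.snd)
  have ht : Primrec fun b : ℕ × (List Bool × List ℕ) × ℕ => b.2.2 :=
    Primrec.snd.comp Primrec.snd
  have hw := Primrec.unpair.comp ((Primrec.list_getD 0).comp hτ ht)
  refine (Primrec.nat_lt.comp ht (Primrec.list_length.comp hτ)).and
    ((Primrec.nat_le.comp (Primrec.fst.comp hw) (Primrec.list_length.comp hσ)).and ?_)
  exact (primrecPred_enumBy Primrec.fst (Primrec.encode.comp (Primrec.pair ht
    (Primrec.list_take.comp (Primrec.fst.comp hw) hσ))) (Primrec.snd.comp hw)).not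

end EffectiveCantor

/-! ### Hardness: uniform indices and unary coding -/

namespace EffectiveCantor

open Set MeasureTheory
open scoped ENNReal

theorem _root_.ComputablePred.comp {α β : Type*} [Primcodable α] [Primcodable β] {R : β → Prop}
    (hR : ComputablePred R) {f : α → β} (hf : Computable f) : ComputablePred fun a => R (f a) := by
  classical exact Computable.computablePred (hR.decide.comp hf)

theorem _root_.ComputablePred.and {α : Type*} [Primcodable α] {P Q : α → Prop}
    (hP : ComputablePred P) (hQ : ComputablePred Q) : ComputablePred fun a => P a ∧ Q a := by
  classical
  exact Computable.computablePred
    ((Primrec.and.to_comp.comp hP.decide hQ.decide).of_eq fun a => by simp)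

/-- A uniformly computable family of sets is uniformly computably enumerable. -/
theorem exists_computable_ceSet_index {β : Type} [Primcodable β] [Inhabited β] {V : ℕ × β → Prop}
    (hV : ComputablePred V) :
    ∃ r : ℕ → ℕ, Computable r ∧ ∀ k b, Encodable.encode b ∈ ceSet (r k) ↔ V (k, b) := by
  have hV' : REPred fun n : ℕ => V (n.unpair.1, decodeD β n.unpair.2) :=
    (hV.comp (Primrec.pair (Primrec.fst.comp Primrec.unpair)
      (primrec_decode_getD.comp (Primrec.snd.comp Primrec.unpair))).to_comp).to_re
  have hV'' := Partrec.nat_iff.1 (Partrec.map hV' (Computable.const 0).to₂)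
  obtain ⟨c, hc⟩ := Nat.Partrec.Code.exists_code.1 hV''
  refine ⟨fun k => Encodable.encode (c.curry k), Computable.encode.comp
    (Nat.Partrec.Code.primrec₂_curry.to_comp.comp (Computable.const c) Computable.id),
    fun k b => ?_⟩
  simp only [ceSet, mem_ofPred_eq, Denumerable.ofNat_encode, Nat.Partrec.Code.eval_curry, hc]
  simp [decodeD, Part.assert]

/-- A chain of strings of unbounded length has a limit; this serves both for writing a unary code
and for reading one. -/
theorem exists_restrict_eq_take {α : Type} [Inhabited α] {L : ℕ → List α}
    (hL : ∀ m n, m ≤ n → L m <+: L n) (hlen : ∀ n, ∃ m, n ≤ (L m).length) :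
    ∃ f : ℕ → α, ∀ n m, n ≤ (L m).length → (L m).take n = restrict f n := by
  choose m hm using fun n => hlen (n + 1)
  have hget : ∀ i j (hj : i < (L j).length), (L j)[i] = (L (m i)).getD i default := by
    intro i j hj
    have hi : i < (L (m i)).length := hm i
    rw [List.getD_eq_getElem _ _ hi]
    rcases le_total j (m i) with h | h
    · exact (hL _ _ h).getElem hj
    · exact ((hL _ _ h).getElem hi).symm
  refine ⟨fun i => (L (m i)).getD i default, fun n j hn => ?_⟩
  refine List.ext_getElem (by simpa using hn) fun i h1 h2 => ?_
  rw [getElem_restrict, List.getElem_take, hget]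

section Coding

/-- One step of reading a unary coded sequence: the numbers read so far and the length of the
current block of zeros. -/
def readStep (s : List ℕ × ℕ) (b : Bool) : List ℕ × ℕ :=
  bif b then (s.1 ++ [s.2], 0) else (s.1, s.2 + 1)

/-- The lengths of the completed blocks of zeros in a binary string. -/
def readUnary (σ : List Bool) : List ℕ := (σ.foldl readStep ([], 0)).1

/-- The binary string in which the entries of `u` are written in unary. -/
def writeUnary (u : List ℕ) : List Bool := u.flatMap fun a => List.replicate a false ++ [true]

theorem isPrefix_foldl_readStep (σ : List Bool) (s : List ℕ × ℕ) :
    s.1 <+: (σ.foldl readStep s).1 := by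
  induction σ generalizing s with
  | nil => exact List.prefix_rfl
  | cons b σ ih =>
    refine List.IsPrefix.trans ?_ (ih (readStep s b))
    cases b <;> simp [readStep]

theorem readUnary_isPrefix {σ τ : List Bool} (h : σ <+: τ) : readUnary σ <+: readUnary τ := by
  obtain ⟨ρ, rfl⟩ := h
  rw [readUnary, readUnary, List.foldl_append]
  exact isPrefix_foldl_readStep _ _

theorem foldl_readStep_replicate (a : ℕ) (s : List ℕ × ℕ) :
    (List.replicate a false).foldl readStep s = (s.1, s.2 + a) := by
  induction a generalizing s with
  | zero => rfl
  | succ a ih =>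
    rw [List.replicate_succ, List.foldl_cons, ih]
    simp [readStep, add_left_comm, add_comm]

theorem foldl_readStep_writeUnary (u v : List ℕ) :
    (writeUnary u).foldl readStep (v, 0) = (v ++ u, 0) := by
  induction u generalizing v with
  | nil => simp [writeUnary]
  | cons a u ih =>
    have : writeUnary (a :: u) = List.replicate a false ++ [true] ++ writeUnary u := by
      simp [writeUnary]
    rw [this, List.foldl_append, List.foldl_append, foldl_readStep_replicate]
    simp [readStep, ih]

theorem readUnary_writeUnary (u : List ℕ) : readUnary (writeUnary u) = u := by
  simp [readUnary, foldl_readStep_writeUnary]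

theorem writeUnary_isPrefix {u v : List ℕ} (h : u <+: v) : writeUnary u <+: writeUnary v := by
  obtain ⟨w, rfl⟩ := h
  simp [writeUnary]

theorem length_le_length_writeUnary (u : List ℕ) : u.length ≤ (writeUnary u).length := by
  induction u with
  | nil => simp
  | cons a u ih =>
    simp only [writeUnary, List.flatMap_cons, List.length_append, List.length_cons] at ih ⊢
    omega

theorem exists_unary_code (f : ℕ → ℕ) :
    ∃ y : Cantor, ∀ n, ∃ m, readUnary (restrict y m) = restrict f n := by
  obtain ⟨y, hy⟩ := exists_restrict_eq_take (L := fun n => writeUnary (restrict f n))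
    (fun m n h => writeUnary_isPrefix (restrict_isPrefix f h)) fun n => ⟨n, by
      simpa using length_le_length_writeUnary (restrict f n)⟩
  refine ⟨y, fun n => ⟨(writeUnary (restrict f n)).length, ?_⟩⟩
  rw [← hy _ n le_rfl, List.take_length, readUnary_writeUnary]

/-- The hypothesis excludes sequences with finitely many ones, which code only a finite string. -/
theorem exists_of_readUnary {y : Cantor} (h : ∀ n, ∃ m, n ≤ (readUnary (restrict y m)).length) :
    ∃ f : ℕ → ℕ, ∀ n m, n ≤ (readUnary (restrict y m)).length →
      (readUnary (restrict y m)).take n = restrict f n :=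
  exists_restrict_eq_take (L := fun n => readUnary (restrict y n))
    (fun _ _ hmn => readUnary_isPrefix (restrict_isPrefix y hmn)) h

/-- The entries of a binary string at the multiples of `q`. -/
def sparseBits (q : ℕ) (σ : List Bool) : List Bool :=
  (List.range (σ.length / q)).map fun i => σ.getD (q * i) false

theorem sparseBits_restrict {q : ℕ} (x : Cantor) (m : ℕ) :
    sparseBits q (restrict x m) = restrict (fun i => x (q * i)) (m / q) := by
  rw [sparseBits, length_restrict, restrict]
  refine List.map_congr_left fun i hi => getD_restrict ?_ _
  have hi := List.mem_range.1 hi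
  rcases q.eq_zero_or_pos with rfl | hq
  · simp at hi
  · rw [Nat.lt_div_iff_mul_lt hq] at hi
    rw [mul_comm]
    omega

theorem primrec_readUnary : Primrec readUnary := by
  refine Primrec.fst.comp (Primrec.list_foldl (g := fun _ => (([], 0) : List ℕ × ℕ))
    (h := fun _ b => readStep b.1 b.2) Primrec.id (Primrec.const _) ?_)
  have h1 := Primrec.fst.comp (Primrec.snd (α := List Bool) (β := (List ℕ × ℕ) × Bool))
  have hb := Primrec.snd.comp (Primrec.snd (α := List Bool) (β := (List ℕ × ℕ) × Bool))
  exact Primrec.cond hb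
    (Primrec.pair (Primrec.list_concat.comp (Primrec.fst.comp h1) (Primrec.snd.comp h1))
      (Primrec.const 0))
    (Primrec.pair (Primrec.fst.comp h1) (Primrec.succ.comp (Primrec.snd.comp h1)))

theorem primrec_sparseBits (q : ℕ) : Primrec (sparseBits q) :=
  Primrec.list_map (Primrec.list_range.comp (Primrec.nat_div.comp Primrec.list_length
    (Primrec.const q))) ((Primrec.list_getD false).comp Primrec.fst
      (Primrec.nat_mul.comp (Primrec.const q) Primrec.snd))

end Coding

/-! ### Mass distribution on sequences with prescribed sparse bits -/

section Measure

variable {p q : ℕ}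

/-- The uniform measure on binary sequences which have the values `y` at the multiples of `q`. -/
noncomputable def sparseFixed (q : ℕ) (y : Cantor) : Measure Cantor :=
  Measure.infinitePi fun i =>
    ((if q ∣ i then PMF.pure (y (i / q)) else PMF.uniformOfFintype Bool : PMF Bool)).toMeasure

instance (q : ℕ) (y : Cantor) : IsProbabilityMeasure (sparseFixed q y) := by
  unfold sparseFixed
  infer_instance

theorem prod_le_weight (hpq : p < q) (n : ℕ) :
    ∏ i ∈ Finset.range n, (if q ∣ i then 1 else 2⁻¹ : ℝ≥0∞) ≤ 2 * weight p q n := by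
  have hq : 0 < q := by omega
  -- Here c counts the fixed positions and d the free ones. The bound says c ≤ ⌈n/q⌉, and with p ≤ q
  -- - 1 it gives ⌊pn/q⌋ ≤ d + 1; the factor 2 pays for the extra 1.
  have key : ∃ c d, c + d = n ∧ q * c < n + q ∧
      ∏ i ∈ Finset.range n, (if q ∣ i then 1 else 2⁻¹ : ℝ≥0∞) = 2⁻¹ ^ d := by
    induction n with
    | zero => exact ⟨0, 0, by simp [hq]⟩
    | succ n ih =>
      obtain ⟨c, d, hcd, hc, hprod⟩ := ih
      rw [Finset.prod_range_succ, hprod]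
      by_cases h : q ∣ n
      · obtain ⟨a, rfl⟩ := h
        have : c < a + 1 := lt_of_mul_lt_mul_left (a := q) (by linarith) (Nat.zero_le q)
        refine ⟨c + 1, d, by omega, ?_, by simp⟩
        have := Nat.mul_le_mul_left q (Nat.le_of_lt_succ this)
        rw [mul_add]
        omega
      · exact ⟨c, d + 1, by omega, by omega, by simp [h, pow_succ]⟩
  obtain ⟨c, d, hcd, hc, hprod⟩ := key
  have hd : p * n / q ≤ d + 1 := by
    refine Nat.lt_succ_iff.1 ((Nat.div_lt_iff_lt_mul hq).2 ?_)
    obtain ⟨r, rfl⟩ : ∃ r, q = p + 1 + r := ⟨q - (p + 1), by omega⟩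
    subst hcd
    nlinarith
  calc _ = (2 : ℝ≥0∞) * 2⁻¹ ^ (d + 1) := by
        rw [hprod, pow_succ', ← mul_assoc, ENNReal.mul_inv_cancel two_ne_zero ENNReal.ofNat_ne_top,
          one_mul]
    _ ≤ 2 * weight p q n := by
        gcongr
        exact pow_le_pow_right_of_le_one' (by simp) hd

theorem sparseFixed_cyl_le (hpq : p < q) (y : Cantor) (σ : List Bool) :
    sparseFixed q y (cyl σ) ≤ 2 * weight p q σ.length := by
  have hsub : cyl σ ⊆ ((Finset.range σ.length : Finset ℕ) : Set ℕ).pi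
      fun i => {σ.getD i false} := by
    intro x hx i hi
    rw [mem_singleton_iff, ← show restrict x σ.length = σ from hx]
    exact (getD_restrict (Finset.mem_range.1 hi) _).symm
  refine (measure_mono hsub).trans (le_trans ?_ (prod_le_weight hpq _))
  rw [sparseFixed, Measure.infinitePi_pi _ fun _ _ => measurableSet_singleton _]
  refine Finset.prod_le_prod' fun i _ => ?_
  split_ifs with h
  · exact prob_le_one
  · rw [PMF.toMeasure_apply_singleton _ _ (measurableSet_singleton _)]
    simp

theorem ae_sparseFixed (hq : 0 < q) (y : Cantor) :
    ∀ᵐ x ∂sparseFixed q y, ∀ i, x (q * i) = y i := by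
  refine ae_all_iff.2 fun i => ?_
  rw [ae_iff]
  have hset : {x : Cantor | ¬ x (q * i) = y i} =
      (({q * i} : Finset ℕ) : Set ℕ).pi fun _ => {y i}ᶜ := by
    ext x
    simp only [Finset.coe_singleton, singleton_pi', mem_ofPred_eq, mem_compl_iff,
      mem_singleton_iff]
  rw [hset, sparseFixed, Measure.infinitePi_pi _ fun _ _ => (measurableSet_singleton _).compl,
    Finset.prod_singleton, if_pos (dvd_mul_right q i), Nat.mul_div_cancel_left i hq,
    PMF.toMeasure_pure]
  simp

/-- Mass distribution principle: a probability measure carried by A gives each cylinder at most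
twice its weight, so no cover of A weighs less than 1/2. -/
theorem content_ne_zero_of_sparse (hpq : p < q) (y : Cantor) {A : Set Cantor}
    (hA : {x : Cantor | ∀ i, x (q * i) = y i} ⊆ A) : content (weight p q) A ≠ 0 := by
  intro h0
  obtain ⟨F, hF, hFs⟩ := exists_cover_of_content_lt
    (h0 ▸ ENNReal.inv_pos.2 ENNReal.ofNat_ne_top : content (weight p q) A < 2⁻¹)
  have h1 : (1 : ℝ≥0∞) ≤ sparseFixed q y (⋃ σ ∈ F, cyl σ) := by
    refine le_of_eq_of_le (measure_univ (μ := sparseFixed q y)).symm (measure_mono_ae ?_)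
    filter_upwards [ae_sparseFixed (by omega) y] with x hx _
    exact hF (hA hx)
  have h2 : (1 : ℝ≥0∞) < 2 * 2⁻¹ := by
    refine (h1.trans ((measure_biUnion_le _ F.to_countable _).trans ?_)).trans_lt
      (ENNReal.mul_lt_mul_right two_ne_zero ENNReal.ofNat_ne_top hFs)
    rw [← ENNReal.tsum_mul_left]
    exact ENNReal.tsum_le_tsum fun σ => sparseFixed_cyl_le hpq y σ
  rw [ENNReal.mul_inv_cancel two_ne_zero ENNReal.ofNat_ne_top] at h2
  exact lt_irrefl _ h2

end Measure

/-! ### The reduction and the main theorem -/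

variable {p q : ℕ}

theorem manyOneReducible_pi02Class (hp : 0 < p) (hpq : p < q) {B : Set ℕ} (hB : IsSigma11 B) :
    (fun k => k ∈ B) ≤₀ fun k => k ∈ {e | hausdorff ((p : ℝ) / q) (pi02Class e) ≠ 0} := by
  have hq : 0 < q := hp.trans hpq
  obtain ⟨R, hR, hRB⟩ := hB
  -- Besides R, the n-th open set demands n decoded entries, so that the intersection forces a total
  -- f.
  let V : ℕ × ℕ × List Bool → Prop := fun b =>
    b.2.1 ≤ (readUnary (sparseBits q b.2.2)).length ∧
      R (b.1, (readUnary (sparseBits q b.2.2)).take b.2.1)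
  have hu : Primrec fun b : ℕ × ℕ × List Bool => readUnary (sparseBits q b.2.2) :=
    primrec_readUnary.comp ((primrec_sparseBits q).comp (Primrec.snd.comp Primrec.snd))
  have hn : Primrec fun b : ℕ × ℕ × List Bool => b.2.1 := Primrec.fst.comp Primrec.snd
  have hV : ComputablePred V :=
    (Primrec.nat_le.comp hn (Primrec.list_length.comp hu)).computablePred.and
      (hR.comp (Primrec.pair Primrec.fst (Primrec.list_take.comp hn hu)).to_comp)
  obtain ⟨r, hr, hrV⟩ := exists_computable_ceSet_index hV
  refine ⟨r, hr, fun k => ?_⟩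
  change k ∈ B ↔ ¬ hausdorff ((p : ℝ) / q) (pi02Class (r k)) = 0
  rw [hausdorff_eq_zero_iff hp hq hpq.le, hRB]
  have hmem : ∀ x : Cantor, x ∈ pi02Class (r k) ↔ ∀ n, ∃ m,
      n ≤ (readUnary (restrict (fun i => x (q * i)) (m / q))).length ∧
        R (k, (readUnary (restrict (fun i => x (q * i)) (m / q))).take n) := by
    intro x
    simp only [pi02Class, mem_ofPred_eq, hrV, V, sparseBits_restrict]
  constructor
  · rintro ⟨f, hf⟩
    obtain ⟨y, hy⟩ := exists_unary_code f
    refine content_ne_zero_of_sparse hpq y fun x hx => (hmem x).2 fun n => ?_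
    obtain ⟨m, hm⟩ := hy n
    -- The first q * m bits of x contain exactly the first m bits of y.
    refine ⟨q * m, ?_⟩
    have hxy : (fun i => x (q * i)) = y := funext hx
    rw [Nat.mul_div_cancel_left m hq, hxy, hm, length_restrict, take_restrict f le_rfl]
    exact ⟨le_rfl, hf n⟩
  · intro hne
    obtain ⟨x, hx⟩ : (pi02Class (r k)).Nonempty := by
      by_contra hempty
      refine hne (le_antisymm ((content_le (F := ∅) ?_).trans (by simp)) bot_le)
      simp [not_nonempty_iff_eq_empty.1 hempty]
    have hx := (hmem x).1 hx
    obtain ⟨f, hf⟩ := exists_of_readUnary (y := fun i => x (q * i)) fun n => by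
      obtain ⟨m, hm, -⟩ := hx n
      exact ⟨m / q, hm⟩
    refine ⟨f, fun n => ?_⟩
    obtain ⟨m, hm, hRm⟩ := hx n
    rwa [hf n _ hm] at hRm

end EffectiveCantor

theorem mainTheorem3 (s : ℚ) (hs0 : 0 < s) (hs1 : s < 1) :
    EffectiveCantor.IsSigma11Complete
        {e : ℕ | EffectiveCantor.hausdorff (s : ℝ) (EffectiveCantor.pi02Class e) ≠ 0} ∧
      EffectiveCantor.IsSigma11
        {e : ℕ | EffectiveCantor.hausdorff (s : ℝ) (EffectiveCantor.sigma11Class e) ≠ 0} := by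
  obtain ⟨p, q, hp, hpq, hs⟩ : ∃ p q : ℕ, 0 < p ∧ p < q ∧ s = (p : ℚ) / q := by
    have hnum : ((s.num.toNat : ℕ) : ℤ) = s.num := Int.toNat_of_nonneg (Rat.num_pos.2 hs0).le
    have hpos := Rat.num_pos.2 hs0
    have hlt := Rat.num_lt_denom_iff.2 hs1
    refine ⟨s.num.toNat, s.den, by omega, by omega, ?_⟩
    rw [← Int.cast_natCast, hnum, Rat.num_div_den]
  have hsR : (s : ℝ) = (p : ℝ) / q := by rw [hs]; push_cast; rfl
  rw [hsR]
  have hq : 0 < q := hp.trans hpq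
  exact ⟨⟨EffectiveCantor.isSigma11_pi02Class hp hq hpq.le, fun _ hB =>
    EffectiveCantor.manyOneReducible_pi02Class hp hpq hB⟩,
    EffectiveCantor.isSigma11_sigma11Class hp hq hpq.le⟩
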